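/- Let $X$ be a complex normed space. For $x,y\in X$ put $$\rho_{+}(x,y)=\lim_{t\to0^{+}}\frac{\|x+ty\|^2-\|x\|^2}{2t},\qquad \rho_{\infty}(x,y)=\frac1\pi\int_0^{2\pi}e^{i\theta}\rho_{+}(x,e^{i\theta}y)\,d\theta ,$$ and write $x\perp_{\rho_\infty}y$ if $\rho_\infty(x,y)=0$. A semi-inner product on $X$ (generating its norm) is a map $[\cdot,\cdot]:X\times X\to\mathbb{C}$ such that, for all $x,y,z\in X$ and $\alpha\in\mathbb{C}$, $[\alpha x+y,z]=\alpha[x,z]+[y,z]$, $[x,\alpha y]=\overline{\alpha}[x,y]$, $[x,x]=\|x\|^2$ and $|[x,y]|\le\|x\|\|y\|$. Let $X$ and $Y$ be complex normed spaces and let $T:X\to Y$ be a non-zero bounded linear map. The following conditions are equivalent: (i) $T$ preserves $\rho_\infty$-orthogonality, that is, for all $x,y\in X$, $x\perp_{\rho_\infty}y$ implies $Tx\perp_{\rho_\infty}Ty$; (ii) $\|Tx\|=\|T\|\,\|x\|$ for all $x\in X$; (iii) $\rho_\infty(Tx,Ty)=\|T\|^2\rho_\infty(x,y)$ for all $x,y\in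 X$. If $X=Y$, then each of these conditions is also equivalent to (iv) there exists a semi-inner product $[\cdot,\cdot]$ on $X$ (generating its norm) such that $[Tx,Ty]=\|T\|^2[x,y]$ for all $x,y\in X$. -/

import Mathlib

namespace RhoInfty

open Filter Topology

noncomputable section

/-- The right norm derivative
`ρ₊(x, y) = lim_{t → 0⁺} (‖x + t y‖² - ‖x‖²) / (2 t)`.
The limit always exists, see `tendsto_rhoPlus`. -/
def rhoPlus {X : Type*} [NormedAddCommGroup X] [NormedSpace ℂ X] (x y : X) : ℝ :=
  limUnder (𝓝[>] (0 : ℝ)) (fun t : ℝ => (‖x + (t : ℂ) • y‖ ^ 2 - ‖x‖ ^ 2) / (2 * t))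

/-- `ρ∞(x, y) = (1/π) ∫_0^{2π} e^{iθ} ρ₊(x, e^{iθ} y) dθ`. -/
def rhoInfty {X : Type*} [NormedAddCommGroup X] [NormedSpace ℂ X] (x y : X) : ℂ :=
  (1 / (Real.pi : ℂ)) * ∫ θ in (0 : ℝ)..(2 * Real.pi),
    Complex.exp (θ * Complex.I) * (rhoPlus x (Complex.exp (θ * Complex.I) • y) : ℂ)

/-- `x ⊥_{ρ∞} y`. -/
def RhoInftyOrthogonal {X : Type*} [NormedAddCommGroup X] [NormedSpace ℂ X] (x y : X) : Prop :=
  rhoInfty x y = 0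

/-- `T` preserves `ρ∞`-orthogonality. -/
def PreservesRhoInftyOrthogonality {X Y : Type*} [NormedAddCommGroup X] [NormedSpace ℂ X]
    [NormedAddCommGroup Y] [NormedSpace ℂ Y] (T : X → Y) : Prop :=
  ∀ x y : X, RhoInftyOrthogonal x y → RhoInftyOrthogonal (T x) (T y)

/-- `s` is a semi-inner product on `X` in the sense of Lumer and Giles, generating the given
norm of `X`; `s x y` stands for `[x, y]`. -/
structure IsSemiInnerProduct {X : Type*} [NormedAddCommGroup X] [NormedSpace ℂ X]
    (s : X → X → ℂ) : Prop where
  linear_left : ∀ (α : ℂ) (x y z : X), s (α • x + y) z = α * s x z + s y z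
  conj_smul_right : ∀ (α : ℂ) (x y : X), s x (α • y) = (starRingEnd ℂ) α * s x y
  self_eq : ∀ x : X, s x x = ((‖x‖ ^ 2 : ℝ) : ℂ)
  norm_le : ∀ x y : X, ‖s x y‖ ≤ ‖x‖ * ‖y‖

/-- The limit defining `ρ₊` exists. -/
theorem tendsto_rhoPlus {X : Type*} [NormedAddCommGroup X] [NormedSpace ℂ X] (x y : X) :
    Tendsto (fun t : ℝ => (‖x + (t : ℂ) • y‖ ^ 2 - ‖x‖ ^ 2) / (2 * t)) (𝓝[>] (0 : ℝ))
      (𝓝 (rhoPlus x y)) := by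
  have h1 : ConvexOn ℝ Set.univ (fun t : ℝ => ‖x + (t : ℂ) • y‖) := by
    refine ⟨convex_univ, fun s _ t _ a b ha hb hab => ?_⟩
    have e : x + ((a • s + b • t : ℝ) : ℂ) • y
        = (a : ℂ) • (x + (s : ℂ) • y) + (b : ℂ) • (x + (t : ℂ) • y) := by
      have hab' : (a : ℂ) + (b : ℂ) = 1 := by exact_mod_cast hab
      have hx : x = ((a : ℂ) + (b : ℂ)) • x := by rw [hab', one_smul]
      conv_lhs => rw [hx]
      simp only [smul_eq_mul, Complex.ofReal_add, Complex.ofReal_mul]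
      module
    simp only [e]
    refine (norm_add_le _ _).trans (le_of_eq ?_)
    rw [norm_smul, norm_smul, Complex.norm_of_nonneg ha, Complex.norm_of_nonneg hb]
    rfl
  have h2 : ConvexOn ℝ Set.univ (fun t : ℝ => ‖x + (t : ℂ) • y‖ ^ 2) :=
    h1.pow (fun _ _ => norm_nonneg _) 2
  have h3 := (ConvexOn.hasDerivWithinAt_rightDeriv_of_mem_interior h2 (x := 0) (by simp))
  rw [hasDerivWithinAt_iff_tendsto_slope] at h3
  have h4 := h3.div_const 2
  have hs : Set.Ioi (0 : ℝ) \ {0} = Set.Ioi 0 := by simp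
  simp only [hs] at h4
  refine tendsto_nhds_limUnder ⟨_, h4.congr fun t => ?_⟩
  simp [slope_def_field]
  ring

end

end RhoInfty

/-!
`ρ₊(x, ·)` is sublinear, and averaging the angle `θ` against its reflection `π - θ` turns
sublinearity into `Re ρ∞(x, y) ≤ ρ₊(x, y)`. Hence `Re ρ∞(x + t y, y)` lies between the left and
right derivatives of the convex function `t ↦ ‖x + t y‖² / 2`, so it converges to `ρ₊(x, y)` as
`t → 0⁺`.

Since `ρ∞(x, y + μ x) = ρ∞(x, y) + conj μ ‖x‖²`, every `y` can be made `ρ∞`-orthogonal to `x`, and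
a linear map preserving orthogonality satisfies `‖x‖² ρ∞(T x, T y) = ‖T x‖² ρ∞(x, y)`. By the limit
above `ρ₊` satisfies the same identity, which says that `‖T z‖² / ‖z‖²` has zero right derivative
along every segment avoiding `0`. So this quotient is constant and `T` is a multiple of an isometry.

A linear isometry `U` acts by pullback on the semi-inner products, which form a nonempty compact
convex set in the topology of pointwise convergence. A fixed point of this affine action is a
semi-inner product preserved by `U`.
-/

namespace RhoInfty

open Filter Topology Set
open Complex (exp I)
open scoped ComplexConjugate Pointwise Real

section RhoPlus

variable {X : Type*} [NormedAddCommGroup X] [NormedSpace ℂ X]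

theorem rhoPlus_eq_of_tendsto {x y : X} {a : ℝ}
    (h : Tendsto (fun t : ℝ => (‖x + (t : ℂ) • y‖ ^ 2 - ‖x‖ ^ 2) / (2 * t)) (𝓝[>] 0) (𝓝 a)) :
    rhoPlus x y = a :=
  tendsto_nhds_unique (tendsto_rhoPlus x y) h

theorem tendsto_const_mul_nhdsGT_zero {𝕜 : Type*} [Field 𝕜] [LinearOrder 𝕜]
    [IsStrictOrderedRing 𝕜] [TopologicalSpace 𝕜] [OrderTopology 𝕜] {r : 𝕜} (hr : 0 < r) :
    Tendsto (fun t : 𝕜 => r * t) (𝓝[>] 0) (𝓝[>] 0) :=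
  tendsto_iff_comap.2 (comap_mulLeft_nhdsGT_zero hr).ge

@[simp]
theorem rhoPlus_zero_right (x : X) : rhoPlus x 0 = 0 :=
  rhoPlus_eq_of_tendsto (by simp)

theorem rhoPlus_smul_of_nonneg (x y : X) {r : ℝ} (hr : 0 ≤ r) :
    rhoPlus x ((r : ℂ) • y) = r * rhoPlus x y := by
  rcases hr.eq_or_lt with rfl | hr
  · simp
  have h := (tendsto_rhoPlus x y).comp (tendsto_const_mul_nhdsGT_zero hr)
  refine rhoPlus_eq_of_tendsto ((h.const_mul r).congr fun t => ?_)
  have smul_comm' : ((r * t : ℝ) : ℂ) • y = (t : ℂ) • (r : ℂ) • y := by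
    push_cast
    module
  simp only [Function.comp_apply, smul_comm']
  field_simp

theorem norm_sq_add_smul_add_le (x y z : X) (t : ℂ) :
    ‖x + t • (y + z)‖ ^ 2 ≤ (‖x + (2 * t) • y‖ ^ 2 + ‖x + (2 * t) • z‖ ^ 2) / 2 := by
  have midpoint : (2 : ℂ) • (x + t • (y + z)) = (x + (2 * t) • y) + (x + (2 * t) • z) := by module
  have h : 2 * ‖x + t • (y + z)‖ ≤ ‖x + (2 * t) • y‖ + ‖x + (2 * t) • z‖ := by
    simpa only [← midpoint, norm_smul, Complex.norm_ofNat] using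
      norm_add_le (x + (2 * t) • y) (x + (2 * t) • z)
  nlinarith [norm_nonneg (x + t • (y + z)),
    sq_nonneg (‖x + (2 * t) • y‖ - ‖x + (2 * t) • z‖)]

theorem rhoPlus_add_le (x y z : X) : rhoPlus x (y + z) ≤ rhoPlus x y + rhoPlus x z := by
  have h2 := tendsto_const_mul_nhdsGT_zero (two_pos (α := ℝ))
  refine le_of_tendsto_of_tendsto (tendsto_rhoPlus x (y + z))
    (((tendsto_rhoPlus x y).comp h2).add ((tendsto_rhoPlus x z).comp h2)) ?_
  filter_upwards [self_mem_nhdsWithin] with t (ht : 0 < t)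
  have h := norm_sq_add_smul_add_le x y z t
  simp only [Function.comp_apply, Complex.ofReal_mul, Complex.ofReal_ofNat]
  rw [← add_div, div_le_div_iff₀ (by positivity) (by positivity)]
  nlinarith

theorem norm_add_smul_le (x y : X) {t : ℝ} (ht : 0 ≤ t) :
    ‖x + (t : ℂ) • y‖ ≤ ‖x‖ + t * ‖y‖ :=
  (norm_add_le _ _).trans_eq (by rw [norm_smul, Complex.norm_of_nonneg ht])

theorem rhoPlus_le_norm_mul_norm (x y : X) : rhoPlus x y ≤ ‖x‖ * ‖y‖ := by
  have hlim : Tendsto (fun t : ℝ => ‖x‖ * ‖y‖ + t * (‖y‖ ^ 2 / 2)) (𝓝[>] 0) (𝓝 (‖x‖ * ‖y‖)) :=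
    ((by fun_prop : Continuous fun t : ℝ => ‖x‖ * ‖y‖ + t * (‖y‖ ^ 2 / 2)).tendsto' 0 _
      (by simp)).mono_left nhdsWithin_le_nhds
  refine le_of_tendsto_of_tendsto (tendsto_rhoPlus x y) hlim ?_
  filter_upwards [self_mem_nhdsWithin] with t (ht : 0 < t)
  have hsq := pow_le_pow_left₀ (norm_nonneg _) (norm_add_smul_le x y ht.le) 2
  rw [div_le_iff₀ (by positivity)]
  nlinarith

theorem lipschitzWith_rhoPlus (x : X) : LipschitzWith ‖x‖₊ (rhoPlus x) :=
  LipschitzWith.of_le_add_mul _ fun y z => by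
    have h := rhoPlus_add_le x z (y - z)
    rw [add_sub_cancel] at h
    rw [coe_nnnorm, dist_eq_norm]
    linarith [rhoPlus_le_norm_mul_norm x (y - z)]

theorem tendsto_norm_sq_add_smul (x y : X) :
    Tendsto (fun t : ℝ => ‖x + (t : ℂ) • y‖ ^ 2) (𝓝[>] 0) (𝓝 (‖x‖ ^ 2)) :=
  ((by fun_prop : Continuous fun t : ℝ => ‖x + (t : ℂ) • y‖ ^ 2).tendsto' 0 _
    (by simp)).mono_left nhdsWithin_le_nhds

theorem two_mul_rhoPlus_le (x y : X) : 2 * rhoPlus x y ≤ ‖x + y‖ ^ 2 - ‖x‖ ^ 2 := by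
  suffices h : rhoPlus x y ≤ (‖x + y‖ ^ 2 - ‖x‖ ^ 2) / 2 by linarith
  refine le_of_tendsto (tendsto_rhoPlus x y) ?_
  filter_upwards [Ioc_mem_nhdsGT one_pos] with t ht
  have convex_comb : x + (t : ℂ) • y = ((1 - t : ℝ) : ℂ) • x + (t : ℂ) • (x + y) := by
    push_cast
    module
  have h : ‖x + (t : ℂ) • y‖ ≤ (1 - t) * ‖x‖ + t * ‖x + y‖ := by
    rw [convex_comb]
    refine (norm_add_le _ _).trans_eq ?_
    rw [norm_smul, norm_smul, Complex.norm_of_nonneg ht.1.le,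
      Complex.norm_of_nonneg (sub_nonneg.2 ht.2)]
  have hsq := pow_le_pow_left₀ (norm_nonneg _) h 2
  rw [div_le_div_iff₀ (by linarith [ht.1]) two_pos]
  nlinarith [mul_nonneg (mul_nonneg ht.1.le (sub_nonneg.2 ht.2)) (sq_nonneg (‖x‖ - ‖x + y‖))]

theorem hasDerivWithinAt_norm_sq_add_smul (x y : X) (t : ℝ) :
    HasDerivWithinAt (fun s : ℝ => ‖x + (s : ℂ) • y‖ ^ 2) (2 * rhoPlus (x + (t : ℂ) • y) y)
      (Ici t) t := by
  rw [← hasDerivWithinAt_Ioi_iff_Ici, hasDerivWithinAt_iff_tendsto_slope' self_notMem_Ioi]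
  have hsub : Tendsto (fun s => s - t) (𝓝[>] t) (𝓝[>] 0) := by
    refine tendsto_nhdsWithin_iff.2 ⟨?_, ?_⟩
    · exact ((continuous_sub_right t).tendsto' t 0 (sub_self t)).mono_left nhdsWithin_le_nhds
    · filter_upwards [self_mem_nhdsWithin] with s (hs : t < s)
      exact sub_pos.2 hs
  refine (((tendsto_rhoPlus (x + (t : ℂ) • y) y).comp hsub).const_mul 2).congr fun s => ?_
  have line : x + (t : ℂ) • y + ((s - t : ℝ) : ℂ) • y = x + (s : ℂ) • y := by
    push_cast
    module
  rw [Function.comp_apply, line, slope_def_field]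
  field_simp

theorem rhoPlus_smul_self (x : X) (μ : ℂ) : rhoPlus x (μ • x) = μ.re * ‖x‖ ^ 2 := by
  have hlim : Tendsto (fun t : ℝ => (μ.re + t * (‖μ‖ ^ 2 / 2)) * ‖x‖ ^ 2) (𝓝[>] 0)
      (𝓝 (μ.re * ‖x‖ ^ 2)) :=
    ((by fun_prop : Continuous fun t : ℝ => (μ.re + t * (‖μ‖ ^ 2 / 2)) * ‖x‖ ^ 2).tendsto' 0 _
      (by simp)).mono_left nhdsWithin_le_nhds
  refine rhoPlus_eq_of_tendsto (hlim.congr' ?_)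
  filter_upwards [self_mem_nhdsWithin] with t (ht : 0 < t)
  have norm_sq_one_add : ‖1 + t * μ‖ ^ 2 = 1 + 2 * t * μ.re + t ^ 2 * ‖μ‖ ^ 2 := by
    simp only [Complex.sq_norm, Complex.normSq_apply, Complex.add_re, Complex.add_im,
      Complex.re_ofReal_mul, Complex.im_ofReal_mul, Complex.one_re, Complex.one_im]
    ring
  rw [show x + (t : ℂ) • μ • x = (1 + t * μ) • x by module, norm_smul, mul_pow, norm_sq_one_add]
  field_simp
  ring

theorem rhoPlus_add_smul_self (x y : X) (μ : ℂ) :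
    rhoPlus x (y + μ • x) = rhoPlus x y + μ.re * ‖x‖ ^ 2 := by
  refine le_antisymm ((rhoPlus_add_le _ _ _).trans_eq (by rw [rhoPlus_smul_self])) ?_
  have h := rhoPlus_add_le x (y + μ • x) ((-μ) • x)
  rw [rhoPlus_smul_self, neg_smul, add_neg_cancel_right, Complex.neg_re] at h
  linarith

end RhoPlus

section RhoInfty

variable {X : Type*} [NormedAddCommGroup X] [NormedSpace ℂ X]

theorem continuous_rhoPlus_exp (x y : X) :
    Continuous fun θ : ℝ => rhoPlus x (exp (θ * I) • y) :=
  (lipschitzWith_rhoPlus x).continuous.comp (by fun_prop)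

theorem continuous_exp_mul_rhoPlus_exp (x y : X) :
    Continuous fun θ : ℝ => exp (θ * I) * (rhoPlus x (exp (θ * I) • y) : ℂ) := by
  have := continuous_rhoPlus_exp x y
  fun_prop

theorem exp_ofReal_mul_I_periodic : Function.Periodic (fun θ : ℝ => exp (θ * I)) (2 * π) :=
  fun θ => by
    simpa only [Complex.ofReal_add, Complex.ofReal_mul, Complex.ofReal_ofNat] using
      Complex.exp_mul_I_periodic θ

theorem integral_exp_mul_re (μ : ℂ) :
    ∫ θ in (0 : ℝ)..(2 * π), exp (θ * I) * ((exp (θ * I) * μ).re : ℂ) = π * conj μ := by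
  have expand (θ : ℝ) : exp (θ * I) * ((exp (θ * I) * μ).re : ℂ)
      = exp ((2 * I) * θ) * (μ / 2) + conj μ / 2 := by
    have h_sq : exp ((2 * I) * θ) = exp (θ * I) * exp (θ * I) := by
      rw [← Complex.exp_add]
      ring_nf
    have h_conj : exp (θ * I) * exp (conj (θ * I)) = 1 := by simp [← Complex.exp_add]
    rw [Complex.re_eq_add_conj, map_mul, ← Complex.exp_conj, h_sq]
    linear_combination (conj μ / 2) * h_conj
  have h_period : exp (2 * I * ((2 * π : ℝ) : ℂ)) = 1 :=
    Complex.exp_eq_one_iff.2 ⟨2, by push_cast; ring⟩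
  simp only [expand]
  rw [intervalIntegral.integral_add (Continuous.intervalIntegrable (by fun_prop) _ _)
    (Continuous.intervalIntegrable (by fun_prop) _ _), intervalIntegral.integral_mul_const,
    integral_exp_mul_complex (by simp), h_period, intervalIntegral.integral_const,
    Complex.ofReal_zero, mul_zero, Complex.exp_zero, sub_self, zero_div, zero_mul, zero_add,
    sub_zero, Complex.real_smul]
  push_cast
  ring

theorem rhoInfty_add_smul_self (x y : X) (μ : ℂ) :
    rhoInfty x (y + μ • x) = rhoInfty x y + conj μ * ((‖x‖ ^ 2 : ℝ) : ℂ) := by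
  have hπ : (π : ℂ) ≠ 0 := Complex.ofReal_ne_zero.2 Real.pi_ne_zero
  unfold rhoInfty
  simp only [smul_add, smul_smul, rhoPlus_add_smul_self, Complex.ofReal_add, Complex.ofReal_mul,
    mul_add, ← mul_assoc]
  rw [intervalIntegral.integral_add
    ((continuous_exp_mul_rhoPlus_exp x y).intervalIntegrable _ _)
    (Continuous.intervalIntegrable (by fun_prop) _ _), intervalIntegral.integral_mul_const,
    integral_exp_mul_re, mul_add]
  congr 1
  field_simp

@[simp]
theorem rhoInfty_zero_right (x : X) : rhoInfty x 0 = 0 := by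
  simp [rhoInfty]

@[simp]
theorem rhoInfty_self (x : X) : rhoInfty x x = ((‖x‖ ^ 2 : ℝ) : ℂ) := by
  simpa using rhoInfty_add_smul_self x 0 1

theorem rhoInfty_exp_smul_right (x y : X) (φ : ℝ) :
    rhoInfty x (exp (φ * I) • y) = exp (-φ * I) * rhoInfty x y := by
  set f : ℝ → ℂ := fun θ => exp (θ * I) * (rhoPlus x (exp (θ * I) • y) : ℂ) with hf
  have f_periodic : Function.Periodic f (2 * π) := fun θ => by
    simp only [hf, exp_ofReal_mul_I_periodic θ]
  have shift (θ : ℝ) : exp (θ * I) * (rhoPlus x (exp (θ * I) • exp (φ * I) • y) : ℂ)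
      = exp (-φ * I) * f (θ + φ) := by
    have h_add : exp (θ * I) * exp (φ * I) = exp ((θ + φ : ℝ) * I) := by
      rw [← Complex.exp_add, ← add_mul, Complex.ofReal_add]
    have h_sub : exp (-φ * I) * exp ((θ + φ : ℝ) * I) = exp (θ * I) := by
      rw [← Complex.exp_add]
      push_cast
      ring_nf
    rw [smul_smul, h_add, hf, ← mul_assoc, h_sub]
  simp only [rhoInfty, shift]
  rw [intervalIntegral.integral_const_mul, intervalIntegral.integral_comp_add_right, zero_add,
    add_comm (2 * π), f_periodic.intervalIntegral_add_eq φ 0, zero_add, mul_left_comm]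

theorem rhoInfty_neg_right (x y : X) : rhoInfty x (-y) = -rhoInfty x y := by
  simpa [neg_mul, Complex.exp_neg] using rhoInfty_exp_smul_right x y π

theorem re_rhoInfty (x y : X) :
    (rhoInfty x y).re
      = π⁻¹ * ∫ θ in (0 : ℝ)..(2 * π), Real.cos θ * rhoPlus x (exp (θ * I) • y) := by
  have h := Complex.reCLM.intervalIntegral_comp_comm
    ((continuous_exp_mul_rhoPlus_exp x y).intervalIntegrable
      (μ := MeasureTheory.volume) 0 (2 * π))
  simp only [Complex.reCLM_apply, Complex.re_mul_ofReal, Complex.exp_ofReal_mul_I_re] at h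
  rw [h, rhoInfty, one_div, ← Complex.ofReal_inv, Complex.re_ofReal_mul]

theorem rhoPlus_add_ofReal_smul_le (x y z : X) {r : ℝ} (hr : 0 ≤ r) :
    rhoPlus x (z + (r : ℂ) • y) ≤ rhoPlus x z + r * rhoPlus x y :=
  (rhoPlus_add_le _ _ _).trans_eq (by rw [rhoPlus_smul_of_nonneg x y hr])

-- `e^{iθ}` and `e^{i(π - θ)}` differ by the real number `2 cos θ`, of the same sign as the weight.
theorem cos_mul_rhoPlus_exp_le (x y : X) (θ : ℝ) :
    Real.cos θ * rhoPlus x (exp (θ * I) • y)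
      ≤ Real.cos θ * rhoPlus x (exp ((π - θ : ℝ) * I) • y) + 2 * Real.cos θ ^ 2 * rhoPlus x y := by
  have reflect : exp (θ * I) = exp ((π - θ : ℝ) * I) + ((2 * Real.cos θ : ℝ) : ℂ) := by
    apply Complex.ext <;>
      simp only [Complex.add_re, Complex.add_im, Complex.exp_ofReal_mul_I_re,
        Complex.exp_ofReal_mul_I_im, Complex.ofReal_re, Complex.ofReal_im, Real.cos_pi_sub,
        Real.sin_pi_sub] <;>
      ring
  rcases le_total 0 (Real.cos θ) with hcos | hcos
  · have h := rhoPlus_add_ofReal_smul_le x y (exp ((π - θ : ℝ) * I) • y)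
      (mul_nonneg zero_le_two hcos)
    rw [← add_smul, ← reflect] at h
    linear_combination mul_le_mul_of_nonneg_left h hcos
  · have h := rhoPlus_add_ofReal_smul_le x y (exp (θ * I) • y) (r := -(2 * Real.cos θ))
      (by linarith)
    rw [← add_smul, reflect, Complex.ofReal_neg, add_neg_cancel_right, ← reflect] at h
    linear_combination mul_le_mul_of_nonpos_left h hcos

theorem integral_cos_mul_rhoPlus_exp_pi_sub (x y : X) :
    ∫ θ in (0 : ℝ)..(2 * π), Real.cos θ * rhoPlus x (exp ((π - θ : ℝ) * I) • y)
      = -∫ θ in (0 : ℝ)..(2 * π), Real.cos θ * rhoPlus x (exp (θ * I) • y) := by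
  set f : ℝ → ℝ := fun θ => Real.cos θ * rhoPlus x (exp (θ * I) • y) with hf
  have f_periodic : Function.Periodic f (2 * π) := fun θ => by
    simp only [hf, exp_ofReal_mul_I_periodic θ, Real.cos_add_two_pi]
  have reflect (θ : ℝ) :
      Real.cos θ * rhoPlus x (exp ((π - θ : ℝ) * I) • y) = -f (π - θ) := by
    simp only [hf, Real.cos_pi_sub, neg_mul, neg_neg]
  have period_shift := f_periodic.intervalIntegral_add_eq (π - 2 * π) 0
  rw [sub_add_cancel, zero_add] at period_shift
  simp only [reflect]
  rw [intervalIntegral.integral_neg, intervalIntegral.integral_comp_sub_left, sub_zero,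
    period_shift]

theorem re_rhoInfty_le_rhoPlus (x y : X) : (rhoInfty x y).re ≤ rhoPlus x y := by
  have hcont := continuous_rhoPlus_exp x y
  have hcont' : Continuous fun θ : ℝ => rhoPlus x (exp ((π - θ : ℝ) * I) • y) :=
    hcont.comp (continuous_sub_left π)
  have h := intervalIntegral.integral_mono (μ := MeasureTheory.volume) Real.two_pi_pos.le
    (Continuous.intervalIntegrable (by fun_prop) _ _)
    (Continuous.intervalIntegrable (by fun_prop) _ _) (cos_mul_rhoPlus_exp_le x y)
  rw [intervalIntegral.integral_add (Continuous.intervalIntegrable (by fun_prop) _ _)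
    (Continuous.intervalIntegrable (by fun_prop) _ _), integral_cos_mul_rhoPlus_exp_pi_sub,
    intervalIntegral.integral_mul_const, intervalIntegral.integral_const_mul, integral_cos_sq,
    Real.sin_two_pi, Real.sin_zero] at h
  rw [re_rhoInfty, inv_mul_le_iff₀ Real.pi_pos]
  linarith

theorem neg_rhoPlus_neg_le_re_rhoInfty (x y : X) : -rhoPlus x (-y) ≤ (rhoInfty x y).re := by
  have h := re_rhoInfty_le_rhoPlus x (-y)
  rw [rhoInfty_neg_right, Complex.neg_re] at h
  linarith

theorem tendsto_re_rhoInfty_add_smul (x y : X) :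
    Tendsto (fun t : ℝ => (rhoInfty (x + (t : ℂ) • y) y).re) (𝓝[>] 0) (𝓝 (rhoPlus x y)) := by
  have hq := tendsto_rhoPlus x y
  have hq' := ((hq.comp (tendsto_const_mul_nhdsGT_zero (two_pos (α := ℝ)))).const_mul 2).sub hq
  rw [two_mul (rhoPlus x y), add_sub_cancel_right] at hq'
  refine tendsto_of_tendsto_of_tendsto_of_le_of_le' hq hq' ?_ ?_ <;>
    filter_upwards [self_mem_nhdsWithin] with t (ht : 0 < t)
  · refine le_trans ?_ (neg_rhoPlus_neg_le_re_rhoInfty _ _)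
    have h := two_mul_rhoPlus_le (x + (t : ℂ) • y) ((t : ℂ) • -y)
    rw [smul_neg, add_neg_cancel_right, ← smul_neg, rhoPlus_smul_of_nonneg _ _ ht.le] at h
    rw [div_le_iff₀ (by positivity)]
    linarith
  · refine (re_rhoInfty_le_rhoPlus _ _).trans ?_
    have h := two_mul_rhoPlus_le (x + (t : ℂ) • y) ((t : ℂ) • y)
    have double : x + (t : ℂ) • y + (t : ℂ) • y = x + ((2 * t : ℝ) : ℂ) • y := by
      push_cast
      module
    rw [double, rhoPlus_smul_of_nonneg _ _ ht.le] at h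
    rw [Function.comp_apply, ← sub_nonneg]
    field_simp
    linarith

end RhoInfty

section SemiInnerProduct

-- The Markov–Kakutani argument: limit points of the orbit averages are fixed.
theorem exists_mem_map_eq_self_of_isCompact_of_convex {E : Type*} [AddCommGroup E] [Module ℝ E]
    [TopologicalSpace E] [IsTopologicalAddGroup E] [ContinuousSMul ℝ E] [T2Space E] {K : Set E}
    (hK : IsCompact K) (hconv : Convex ℝ K) (hne : K.Nonempty) (Φ : E →L[ℝ] E)
    (hΦ : MapsTo Φ K K) : ∃ v ∈ K, Φ v = v := by
  obtain ⟨u, hu⟩ := hne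
  have iterate_mem (n : ℕ) : Φ^[n] u ∈ K := hΦ.iterate n hu
  set A : ℕ → E := fun n => birkhoffAverage ℝ Φ id n u with hA
  have average_mem : ∀ᶠ n in atTop, A n ∈ K := by
    filter_upwards [eventually_ne_atTop 0] with n hn
    simp only [hA, birkhoffAverage, birkhoffSum, Finset.smul_sum, id]
    exact hconv.sum_mem (fun _ _ => by positivity) (by simp [hn]) fun k _ => iterate_mem k
  have almost_fixed : Tendsto (fun n => Φ (A n) - A n) atTop (𝓝 0) := by
    have hbdd : Bornology.IsVonNBounded ℝ (K - K) :=
      (hK.isVonNBounded ℝ).sub (hK.isVonNBounded ℝ)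
    refine (hbdd.smul_tendsto_zero (x := fun n => Φ^[n] u - u)
      (.of_forall fun n => Set.sub_mem_sub (iterate_mem n) hu)
      (tendsto_inv_atTop_nhds_zero_nat (𝕜 := ℝ))).congr fun n => ?_
    have map_average : Φ (A n) = birkhoffAverage ℝ Φ id n (Φ u) := by
      simp only [hA, birkhoffAverage, birkhoffSum, map_smul, map_sum, id,
        ← Function.iterate_succ_apply, ← Function.iterate_succ_apply']
    rw [map_average, birkhoffAverage_apply_sub_birkhoffAverage]
    rfl
  obtain ⟨v, hv, hlim⟩ := hK.ultrafilter_le_nhds' ((hyperfilter ℕ).map A)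
    (Nat.hyperfilter_le_atTop average_mem)
  have hlim : Tendsto A (hyperfilter ℕ) (𝓝 v) := hlim
  exact ⟨v, hv, sub_eq_zero.1 (tendsto_nhds_unique
    (((Φ.continuous.tendsto v).comp hlim).sub hlim)
    (almost_fixed.mono_left Nat.hyperfilter_le_atTop))⟩

theorem exists_dual_norm_map_eq_of_isPrincipal {𝕜 E : Type*} [RCLike 𝕜] [NormedAddCommGroup E]
    [NormedSpace 𝕜 E] (L : Submodule 𝕜 E) (hL : L.IsPrincipal) :
    ∃ g : StrongDual 𝕜 E, ‖g‖ ≤ 1 ∧ ∀ y ∈ L, ‖g y‖ = ‖y‖ := by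
  obtain ⟨v, rfl⟩ := hL
  obtain ⟨g, hg, hgv⟩ := exists_dual_vector'' 𝕜 v
  refine ⟨g, hg, fun y hy => ?_⟩
  obtain ⟨a, rfl⟩ := Submodule.mem_span_singleton.1 hy
  simp [hgv, norm_smul]

theorem exists_isSemiInnerProduct (X : Type*) [NormedAddCommGroup X] [NormedSpace ℂ X] :
    ∃ s : X → X → ℂ, IsSemiInnerProduct s := by
  choose! g hg_norm hg_apply using exists_dual_norm_map_eq_of_isPrincipal (𝕜 := ℂ) (E := X)
  let ℓ (y : X) : StrongDual ℂ X := g (Submodule.span ℂ {y})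
  have hℓ_norm (y : X) : ‖ℓ y‖ ≤ 1 := hg_norm _ ⟨y, rfl⟩
  have hℓ_self (y : X) : ‖ℓ y y‖ = ‖y‖ :=
    hg_apply _ ⟨y, rfl⟩ y (Submodule.mem_span_singleton_self y)
  have hℓ_smul {α : ℂ} (hα : α ≠ 0) (y : X) : ℓ (α • y) = ℓ y := by
    simp only [ℓ, Submodule.span_singleton_smul_eq (IsUnit.mk0 α hα)]
  refine ⟨fun x y => ℓ y x * conj (ℓ y y), ?_, ?_, ?_, ?_⟩
  · intro α x y z
    simp only [map_add, map_smul, smul_eq_mul]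
    ring
  · intro α x y
    rcases eq_or_ne α 0 with rfl | hα
    · simp
    · simp only [hℓ_smul hα, map_smul, smul_eq_mul, map_mul]
      ring
  · intro x
    rw [Complex.mul_conj, Complex.normSq_eq_norm_sq, hℓ_self]
  · intro x y
    rw [norm_mul, RCLike.norm_conj, hℓ_self]
    gcongr
    exact ((ℓ y).le_of_opNorm_le (hℓ_norm y) x).trans_eq (one_mul _)

variable {X Y : Type*} [NormedAddCommGroup X] [NormedSpace ℂ X]
  [NormedAddCommGroup Y] [NormedSpace ℂ Y]

theorem IsSemiInnerProduct.smul_left {s : X → X → ℂ} (hs : IsSemiInnerProduct s) (α : ℂ)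
    (x z : X) : s (α • x) z = α * s x z := by
  have zero_left : s 0 z = 0 := by simpa using hs.norm_le 0 z
  simpa [zero_left] using hs.linear_left α x 0 z

theorem IsSemiInnerProduct.comp_linearIsometry {s : Y → Y → ℂ} (hs : IsSemiInnerProduct s)
    (U : X →ₗᵢ[ℂ] Y) : IsSemiInnerProduct fun x y => s (U x) (U y) where
  linear_left α x y z := by rw [map_add, map_smul, hs.linear_left]
  conj_smul_right α x y := by rw [map_smul, hs.conj_smul_right]
  self_eq x := by rw [hs.self_eq, U.norm_map]
  norm_le x y := by simpa only [U.norm_map] using hs.norm_le (U x) (U y)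

theorem convex_setOfPred_isSemiInnerProduct : Convex ℝ {s : X → X → ℂ | IsSemiInnerProduct s} := by
  intro s hs r hr a b ha hb hab
  refine ⟨fun α x y z => ?_, fun α x y => ?_, fun x => ?_, fun x y => ?_⟩ <;>
    simp only [Pi.add_apply, Pi.smul_apply, Complex.real_smul]
  · rw [hs.linear_left, hr.linear_left]
    ring
  · rw [hs.conj_smul_right, hr.conj_smul_right]
    ring
  · rw [hs.self_eq, hr.self_eq, ← add_mul, ← Complex.ofReal_add, hab, Complex.ofReal_one, one_mul]
  · calc ‖(a : ℂ) * s x y + b * r x y‖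
        ≤ a * ‖s x y‖ + b * ‖r x y‖ := by
          refine (norm_add_le _ _).trans_eq ?_
          rw [norm_mul, norm_mul, Complex.norm_of_nonneg ha, Complex.norm_of_nonneg hb]
      _ ≤ a * (‖x‖ * ‖y‖) + b * (‖x‖ * ‖y‖) := by
          gcongr
          exacts [hs.norm_le x y, hr.norm_le x y]
      _ = ‖x‖ * ‖y‖ := by rw [← add_mul, hab, one_mul]

theorem isClosed_setOfPred_isSemiInnerProduct :
    IsClosed {s : X → X → ℂ | IsSemiInnerProduct s} := by
  have fields (s : X → X → ℂ) : IsSemiInnerProduct s ↔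
      (∀ (α : ℂ) (x y z : X), s (α • x + y) z = α * s x z + s y z) ∧
      (∀ (α : ℂ) (x y : X), s x (α • y) = conj α * s x y) ∧
      (∀ x, s x x = ((‖x‖ ^ 2 : ℝ) : ℂ)) ∧ ∀ x y, ‖s x y‖ ≤ ‖x‖ * ‖y‖ :=
    ⟨fun ⟨h₁, h₂, h₃, h₄⟩ => ⟨h₁, h₂, h₃, h₄⟩, fun ⟨h₁, h₂, h₃, h₄⟩ => ⟨h₁, h₂, h₃, h₄⟩⟩
  simp only [fields, ofPred_and, ofPred_forall]
  refine .inter ?_ (.inter ?_ (.inter ?_ ?_))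
  · exact isClosed_iInter fun α => isClosed_iInter fun x => isClosed_iInter fun y =>
      isClosed_iInter fun z => isClosed_eq (by fun_prop) (by fun_prop)
  · exact isClosed_iInter fun α => isClosed_iInter fun x => isClosed_iInter fun y =>
      isClosed_eq (by fun_prop) (by fun_prop)
  · exact isClosed_iInter fun x => isClosed_eq (by fun_prop) (by fun_prop)
  · exact isClosed_iInter fun x => isClosed_iInter fun y =>
      isClosed_le (by fun_prop) (by fun_prop)

theorem isCompact_setOfPred_isSemiInnerProduct :
    IsCompact {s : X → X → ℂ | IsSemiInnerProduct s} :=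
  (isCompact_univ_pi fun x => isCompact_univ_pi fun y =>
    isCompact_closedBall (0 : ℂ) (‖x‖ * ‖y‖)).of_isClosed_subset
      isClosed_setOfPred_isSemiInnerProduct fun s hs x _ y _ => by simpa using hs.norm_le x y

theorem exists_isSemiInnerProduct_invariant (U : X →ₗᵢ[ℂ] X) :
    ∃ s : X → X → ℂ, IsSemiInnerProduct s ∧ ∀ x y, s (U x) (U y) = s x y := by
  let pullback : (X → X → ℂ) →L[ℝ] (X → X → ℂ) := .pi fun x => .pi fun y =>
    (ContinuousLinearMap.proj (R := ℝ) (φ := fun _ : X => ℂ) (U y)).comp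
      (ContinuousLinearMap.proj (R := ℝ) (φ := fun _ : X => X → ℂ) (U x))
  obtain ⟨s, hs, hfix⟩ := exists_mem_map_eq_self_of_isCompact_of_convex
    isCompact_setOfPred_isSemiInnerProduct convex_setOfPred_isSemiInnerProduct
    (exists_isSemiInnerProduct X) pullback fun _ hs => hs.comp_linearIsometry U
  exact ⟨s, hs, fun x y => congrFun₂ hfix x y⟩

end SemiInnerProduct

section Preservers

variable {X Y : Type*} [NormedAddCommGroup X] [NormedSpace ℂ X]
  [NormedAddCommGroup Y] [NormedSpace ℂ Y] {T : X →ₗ[ℂ] Y}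

theorem PreservesRhoInftyOrthogonality.norm_sq_mul_rhoInfty
    (hT : PreservesRhoInftyOrthogonality T) (x y : X) :
    ((‖x‖ ^ 2 : ℝ) : ℂ) * rhoInfty (T x) (T y) = ((‖T x‖ ^ 2 : ℝ) : ℂ) * rhoInfty x y := by
  rcases eq_or_ne x 0 with rfl | hx
  · simp
  have hx' : ((‖x‖ ^ 2 : ℝ) : ℂ) ≠ 0 :=
    Complex.ofReal_ne_zero.2 (pow_ne_zero 2 (norm_ne_zero_iff.2 hx))
  set μ : ℂ := -conj (rhoInfty x y / ((‖x‖ ^ 2 : ℝ) : ℂ)) with hμ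
  have conj_μ : conj μ = -(rhoInfty x y / ((‖x‖ ^ 2 : ℝ) : ℂ)) := by
    rw [hμ, map_neg, Complex.conj_conj]
  have orthogonal : rhoInfty x (y + μ • x) = 0 := by
    rw [rhoInfty_add_smul_self, conj_μ]
    field_simp
    ring
  have map_orthogonal : rhoInfty (T x) (T (y + μ • x)) = 0 := hT x _ orthogonal
  rw [map_add, map_smul, rhoInfty_add_smul_self, conj_μ] at map_orthogonal
  field_simp at map_orthogonal
  linear_combination map_orthogonal

theorem PreservesRhoInftyOrthogonality.norm_sq_mul_rhoPlus
    (hT : PreservesRhoInftyOrthogonality T) (x y : X) :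
    ‖x‖ ^ 2 * rhoPlus (T x) (T y) = ‖T x‖ ^ 2 * rhoPlus x y := by
  have hlim := (tendsto_norm_sq_add_smul x y).mul (tendsto_re_rhoInfty_add_smul (T x) (T y))
  have hlim' := (tendsto_norm_sq_add_smul (T x) (T y)).mul (tendsto_re_rhoInfty_add_smul x y)
  refine tendsto_nhds_unique hlim (hlim'.congr fun t => ?_)
  have h := congrArg Complex.re (hT.norm_sq_mul_rhoInfty (x + (t : ℂ) • y) y)
  rw [Complex.re_ofReal_mul, Complex.re_ofReal_mul, map_add, map_smul] at h
  exact h.symm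

theorem PreservesRhoInftyOrthogonality.norm_map_add_mul_norm
    (hT : PreservesRhoInftyOrthogonality T) {x y : X}
    (hxy : ∀ t ∈ Icc (0 : ℝ) 1, x + (t : ℂ) • y ≠ 0) :
    ‖T (x + y)‖ * ‖x‖ = ‖T x‖ * ‖x + y‖ := by
  set F : ℝ → ℝ := fun t => ‖T x + (t : ℂ) • T y‖ ^ 2 with hF
  set G : ℝ → ℝ := fun t => ‖x + (t : ℂ) • y‖ ^ 2 with hG
  have hG0 : ∀ t ∈ Icc (0 : ℝ) 1, G t ≠ 0 := fun t ht =>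
    pow_ne_zero 2 (norm_ne_zero_iff.2 (hxy t ht))
  have hcont : ContinuousOn (fun t => F t / G t) (Icc 0 1) :=
    ContinuousOn.div (by fun_prop) (by fun_prop) hG0
  have hderiv : ∀ t ∈ Ico (0 : ℝ) 1, HasDerivWithinAt (fun t => F t / G t) 0 (Ici t) t := by
    intro t ht
    refine ((hasDerivWithinAt_norm_sq_add_smul (T x) (T y) t).div
      (hasDerivWithinAt_norm_sq_add_smul x y t) (hG0 t (Ico_subset_Icc_self ht))).congr_deriv ?_
    have h := hT.norm_sq_mul_rhoPlus (x + (t : ℂ) • y) y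
    rw [map_add, map_smul] at h
    rw [div_eq_zero_iff]
    exact .inl (by linear_combination 2 * h)
  have hconst : F 1 / G 1 = F 0 / G 0 :=
    constant_of_has_deriv_right_zero hcont hderiv 1 (right_mem_Icc.2 zero_le_one)
  rw [div_eq_div_iff (hG0 1 (by simp)) (hG0 0 (by simp))] at hconst
  simp only [hF, hG, Complex.ofReal_one, Complex.ofReal_zero, one_smul, zero_smul, add_zero,
    ← mul_pow, ← map_add] at hconst
  exact (pow_left_inj₀ (by positivity) (by positivity) two_ne_zero).1 hconst

theorem PreservesRhoInftyOrthogonality.norm_map_mul_norm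
    (hT : PreservesRhoInftyOrthogonality T) (x y : X) : ‖T y‖ * ‖x‖ = ‖T x‖ * ‖y‖ := by
  by_cases hseg : ∀ t ∈ Icc (0 : ℝ) 1, x + (t : ℂ) • (y - x) ≠ 0
  · simpa only [add_sub_cancel] using hT.norm_map_add_mul_norm hseg
  push Not at hseg
  obtain ⟨t, -, ht⟩ := hseg
  rcases eq_or_ne t 0 with rfl | ht0
  · obtain rfl : x = 0 := by simpa using ht
    simp
  have ht0' : (t : ℂ) ≠ 0 := Complex.ofReal_ne_zero.2 ht0
  obtain rfl : y = (1 - (t : ℂ)⁻¹) • x := by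
    have h : (t : ℂ)⁻¹ • (x + (t : ℂ) • (y - x)) = 0 := by rw [ht, smul_zero]
    rw [smul_add, inv_smul_smul₀ ht0'] at h
    rw [← sub_eq_zero, ← h]
    module
  rw [map_smul, norm_smul, norm_smul]
  ring

theorem PreservesRhoInftyOrthogonality.exists_norm_map_eq
    (hT : PreservesRhoInftyOrthogonality T) : ∃ c : ℝ, ∀ x, ‖T x‖ = c * ‖x‖ := by
  rcases subsingleton_or_nontrivial X with _ | _
  · exact ⟨0, fun x => by simp [Subsingleton.elim x 0]⟩
  obtain ⟨e, he⟩ := exists_ne (0 : X)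
  have he' : ‖e‖ ≠ 0 := norm_ne_zero_iff.2 he
  refine ⟨‖T e‖ / ‖e‖, fun x => ?_⟩
  rw [div_mul_eq_mul_div, eq_div_iff he']
  exact hT.norm_map_mul_norm e x

theorem rhoPlus_map_of_norm_map {c : ℝ} (h : ∀ x, ‖T x‖ = c * ‖x‖) (x y : X) :
    rhoPlus (T x) (T y) = c ^ 2 * rhoPlus x y := by
  refine rhoPlus_eq_of_tendsto (((tendsto_rhoPlus x y).const_mul (c ^ 2)).congr fun t => ?_)
  rw [← map_smul, ← map_add, h, h]
  ring

theorem rhoInfty_map_of_norm_map {c : ℝ} (h : ∀ x, ‖T x‖ = c * ‖x‖) (x y : X) :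
    rhoInfty (T x) (T y) = ((c ^ 2 : ℝ) : ℂ) * rhoInfty x y := by
  unfold rhoInfty
  rw [mul_left_comm, ← intervalIntegral.integral_const_mul ((c ^ 2 : ℝ) : ℂ)]
  simp only [← map_smul, rhoPlus_map_of_norm_map h, Complex.ofReal_mul, mul_left_comm]

theorem norm_eq_abs_mul_norm_of_ofReal_sq {E F : Type*} [SeminormedAddGroup E]
    [SeminormedAddGroup F] {x : E} {y : F} {c : ℝ}
    (h : ((‖y‖ ^ 2 : ℝ) : ℂ) = ((c ^ 2 : ℝ) : ℂ) * ((‖x‖ ^ 2 : ℝ) : ℂ)) : ‖y‖ = |c| * ‖x‖ := by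
  have h_sq : ‖y‖ ^ 2 = (c * ‖x‖) ^ 2 := by
    rw [mul_pow]
    exact_mod_cast h
  rwa [sq_eq_sq_iff_abs_eq_abs, abs_mul, abs_norm, abs_norm] at h_sq

theorem norm_map_eq_abs_mul_of_rhoInfty_map {c : ℝ}
    (h : ∀ x y, rhoInfty (T x) (T y) = ((c ^ 2 : ℝ) : ℂ) * rhoInfty x y) (x : X) :
    ‖T x‖ = |c| * ‖x‖ :=
  norm_eq_abs_mul_norm_of_ofReal_sq (by simpa only [rhoInfty_self] using h x x)

theorem preservesRhoInftyOrthogonality_of_norm_map {c : ℝ} (h : ∀ x, ‖T x‖ = c * ‖x‖) :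
    PreservesRhoInftyOrthogonality T := fun x y (hxy : rhoInfty x y = 0) => by
  rw [RhoInftyOrthogonal, rhoInfty_map_of_norm_map h, hxy, mul_zero]

theorem tfae_preservesRhoInftyOrthogonality (T : X →ₗ[ℂ] Y) :
    List.TFAE [
      PreservesRhoInftyOrthogonality T,
      ∃ c : ℝ, ∀ x, ‖T x‖ = c * ‖x‖,
      ∃ c : ℝ, ∀ x y, rhoInfty (T x) (T y) = ((c ^ 2 : ℝ) : ℂ) * rhoInfty x y] := by
  tfae_have 1 → 2 := fun h => h.exists_norm_map_eq
  tfae_have 2 → 1 := fun ⟨_, h⟩ => preservesRhoInftyOrthogonality_of_norm_map h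
  tfae_have 2 → 3 := fun ⟨c, h⟩ => ⟨c, rhoInfty_map_of_norm_map h⟩
  tfae_have 3 → 2 := fun ⟨c, h⟩ => ⟨|c|, norm_map_eq_abs_mul_of_rhoInfty_map h⟩
  tfae_finish

end Preservers

section Endomorphisms

variable {X : Type*} [NormedAddCommGroup X] [NormedSpace ℂ X] {T : X →ₗ[ℂ] X}

theorem IsSemiInnerProduct.norm_map_eq_abs_mul {s : X → X → ℂ} (hs : IsSemiInnerProduct s) {c : ℝ}
    (h : ∀ x y, s (T x) (T y) = ((c ^ 2 : ℝ) : ℂ) * s x y) (x : X) : ‖T x‖ = |c| * ‖x‖ :=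
  norm_eq_abs_mul_norm_of_ofReal_sq (by simpa only [hs.self_eq] using h x x)

theorem exists_isSemiInnerProduct_of_norm_map {c : ℝ} (h : ∀ x, ‖T x‖ = c * ‖x‖) :
    ∃ s : X → X → ℂ, IsSemiInnerProduct s ∧
      ∀ x y, s (T x) (T y) = ((c ^ 2 : ℝ) : ℂ) * s x y := by
  rcases eq_or_ne c 0 with rfl | hc
  · obtain ⟨s, hs⟩ := exists_isSemiInnerProduct X
    exact ⟨s, hs, fun x y => by simpa [h] using hs.norm_le (T x) (T y)⟩
  have hc' : (c : ℂ) ≠ 0 := Complex.ofReal_ne_zero.2 hc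
  have norm_inv_smul (x : X) : ‖((c : ℂ)⁻¹ • T) x‖ = ‖x‖ := by
    have norm_T : ‖T x‖ = |c| * ‖x‖ := by
      rw [← abs_norm (T x), h, abs_mul, abs_norm]
    rw [LinearMap.smul_apply, norm_smul, norm_inv, Complex.norm_real, Real.norm_eq_abs,
      norm_T, inv_mul_cancel_left₀ (abs_ne_zero.2 hc)]
  let U : X →ₗᵢ[ℂ] X := ⟨(c : ℂ)⁻¹ • T, norm_inv_smul⟩
  have T_eq (x : X) : T x = (c : ℂ) • U x := (smul_inv_smul₀ hc' (T x)).symm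
  obtain ⟨s, hs, hinv⟩ := exists_isSemiInnerProduct_invariant U
  refine ⟨s, hs, fun x y => ?_⟩
  rw [T_eq, T_eq, hs.smul_left, hs.conj_smul_right, hinv, Complex.conj_ofReal, ← mul_assoc,
    Complex.ofReal_pow, sq]

theorem exists_norm_map_eq_iff_exists_isSemiInnerProduct (T : X →ₗ[ℂ] X) :
    (∃ c : ℝ, ∀ x, ‖T x‖ = c * ‖x‖) ↔
      ∃ c : ℝ, ∃ s : X → X → ℂ, IsSemiInnerProduct s ∧
        ∀ x y, s (T x) (T y) = ((c ^ 2 : ℝ) : ℂ) * s x y :=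
  ⟨fun ⟨c, h⟩ => ⟨c, exists_isSemiInnerProduct_of_norm_map h⟩,
    fun ⟨c, _, hs, h⟩ => ⟨|c|, hs.norm_map_eq_abs_mul h⟩⟩

end Endomorphisms

section OpNorm

variable {𝕜 E F : Type*} [NontriviallyNormedField 𝕜] [NormedAddCommGroup E] [NormedSpace 𝕜 E]
  [SeminormedAddCommGroup F] [NormedSpace 𝕜 F]

theorem norm_map_eq_opNorm_mul {T : E →L[𝕜] F} {c : ℝ} (h : ∀ x, ‖T x‖ = c * ‖x‖) (x : E) :
    ‖T x‖ = ‖T‖ * ‖x‖ := by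
  rcases subsingleton_or_nontrivial E with _ | _
  · simp [Subsingleton.elim x 0]
  · rw [T.homothety_norm h, h]

theorem exists_norm_map_eq_iff (T : E →L[𝕜] F) :
    (∃ c : ℝ, ∀ x, ‖T x‖ = c * ‖x‖) ↔ ∀ x, ‖T x‖ = ‖T‖ * ‖x‖ :=
  ⟨fun ⟨_, h⟩ => norm_map_eq_opNorm_mul h, fun h => ⟨_, h⟩⟩

theorem exists_iff_opNorm {T : E →L[𝕜] F} {P : ℝ → Prop}
    (of_norm_map : ∀ c, (∀ x, ‖T x‖ = c * ‖x‖) → P c)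
    (norm_map : ∀ c, P c → ∀ x, ‖T x‖ = |c| * ‖x‖) : (∃ c, P c) ↔ P ‖T‖ :=
  ⟨fun ⟨_, hc⟩ => of_norm_map _ (norm_map_eq_opNorm_mul (norm_map _ hc)), fun h => ⟨_, h⟩⟩

variable {X Y : Type*} [NormedAddCommGroup X] [NormedSpace ℂ X]
  [NormedAddCommGroup Y] [NormedSpace ℂ Y]

theorem exists_rhoInfty_map_eq_iff (T : X →L[ℂ] Y) :
    (∃ c : ℝ, ∀ x y, rhoInfty (T x) (T y) = ((c ^ 2 : ℝ) : ℂ) * rhoInfty x y) ↔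
      ∀ x y, rhoInfty (T x) (T y) = ((‖T‖ ^ 2 : ℝ) : ℂ) * rhoInfty x y :=
  exists_iff_opNorm (fun _ h => rhoInfty_map_of_norm_map (T := T.toLinearMap) h)
    fun _ h => norm_map_eq_abs_mul_of_rhoInfty_map (T := T.toLinearMap) h

theorem exists_isSemiInnerProduct_map_eq_iff (T : X →L[ℂ] X) :
    (∃ c : ℝ, ∃ s : X → X → ℂ, IsSemiInnerProduct s ∧
        ∀ x y, s (T x) (T y) = ((c ^ 2 : ℝ) : ℂ) * s x y) ↔
      ∃ s : X → X → ℂ, IsSemiInnerProduct s ∧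
        ∀ x y, s (T x) (T y) = ((‖T‖ ^ 2 : ℝ) : ℂ) * s x y :=
  exists_iff_opNorm (fun _ h => exists_isSemiInnerProduct_of_norm_map (T := T.toLinearMap) h)
    fun _ ⟨_, hs, h⟩ => hs.norm_map_eq_abs_mul (T := T.toLinearMap) h

end OpNorm

end RhoInfty

theorem mainTheorem1_general {X Y : Type*} [NormedAddCommGroup X] [NormedSpace ℂ X]
    [NormedAddCommGroup Y] [NormedSpace ℂ Y] :
    (∀ T : X →ₗ[ℂ] Y,
      List.TFAE [
        RhoInfty.PreservesRhoInftyOrthogonality (fun x => T x),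
        ∃ c : ℝ, ∀ x : X, ‖T x‖ = c * ‖x‖,
        ∃ c : ℝ, ∀ x y : X,
          RhoInfty.rhoInfty (T x) (T y) = ((c ^ 2 : ℝ) : ℂ) * RhoInfty.rhoInfty x y]) ∧
    (∀ T : X →ₗ[ℂ] X,
      List.TFAE [
        RhoInfty.PreservesRhoInftyOrthogonality (fun x => T x),
        ∃ c : ℝ, ∀ x : X, ‖T x‖ = c * ‖x‖,
        ∃ c : ℝ, ∀ x y : X,
          RhoInfty.rhoInfty (T x) (T y) = ((c ^ 2 : ℝ) : ℂ) * RhoInfty.rhoInfty x y,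
        ∃ c : ℝ, ∃ s : X → X → ℂ, RhoInfty.IsSemiInnerProduct s ∧
          ∀ x y : X, s (T x) (T y) = ((c ^ 2 : ℝ) : ℂ) * s x y]) := by
  refine ⟨RhoInfty.tfae_preservesRhoInftyOrthogonality, fun T => ?_⟩
  have h := RhoInfty.tfae_preservesRhoInftyOrthogonality T
  tfae_have 1 ↔ 2 := h.out 0 1
  tfae_have 2 ↔ 3 := h.out 1 2
  tfae_have 2 ↔ 4 := RhoInfty.exists_norm_map_eq_iff_exists_isSemiInnerProduct T
  tfae_finish

theorem mainTheorem1 {X Y : Type*} [NormedAddCommGroup X] [NormedSpace ℂ X]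
    [NormedAddCommGroup Y] [NormedSpace ℂ Y] :
    (∀ T : X →L[ℂ] Y, T ≠ 0 →
      List.TFAE [
        RhoInfty.PreservesRhoInftyOrthogonality (fun x => T x),
        ∀ x : X, ‖T x‖ = ‖T‖ * ‖x‖,
        ∀ x y : X,
          RhoInfty.rhoInfty (T x) (T y) = ((‖T‖ ^ 2 : ℝ) : ℂ) * RhoInfty.rhoInfty x y]) ∧
    (∀ T : X →L[ℂ] X, T ≠ 0 →
      List.TFAE [
        RhoInfty.PreservesRhoInftyOrthogonality (fun x => T x),
        ∀ x : X, ‖T x‖ = ‖T‖ * ‖x‖,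
        ∀ x y : X,
          RhoInfty.rhoInfty (T x) (T y) = ((‖T‖ ^ 2 : ℝ) : ℂ) * RhoInfty.rhoInfty x y,
        ∃ s : X → X → ℂ, RhoInfty.IsSemiInnerProduct s ∧
          ∀ x y : X, s (T x) (T y) = ((‖T‖ ^ 2 : ℝ) : ℂ) * s x y]) :=
  ⟨fun T _ => by
    simpa only [ContinuousLinearMap.coe_coe, RhoInfty.exists_norm_map_eq_iff,
      RhoInfty.exists_rhoInfty_map_eq_iff] using mainTheorem1_general.1 T.toLinearMap,
  fun T _ => by
    simpa only [ContinuousLinearMap.coe_coe, RhoInfty.exists_norm_map_eq_iff,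
      RhoInfty.exists_rhoInfty_map_eq_iff, RhoInfty.exists_isSemiInnerProduct_map_eq_iff]
      using (mainTheorem1_general (Y := X)).2 T.toLinearMap⟩
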